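/- Let $c\ge 0$ and let $\mathbb{H}_c=L^2(\mathbb{R},e^{-2ct}\,dt)$ be the complex Hilbert space of (classes of) measurable functions $f:\mathbb{R}\to\mathbb{C}$ with $\int_{\mathbb{R}}|f(t)|^2e^{-2ct}\,dt<\infty$. Let $AC(\mathbb{R})$ be the space of functions $\mathbb{R}\to\mathbb{C}$ that are absolutely continuous on every compact interval, and let the infinitesimal shift be the operator $$\partial_c f=f',\qquad D(\partial_c)=\{f\in\mathbb{H}_c\cap AC(\mathbb{R}) : f'\in\mathbb{H}_c\}.$$ Let $V_c=\frac{1}{i}(\partial_c-c)$ on $D(\partial_c)$, where $c$ stands for $c$ times the identity of $D(\partial_c)$, and let $V_0=\frac1i\frac{d}{dt}$ with domain $\{f\in L^2(\mathbb{R})\cap AC(\mathbb{R}) : f'\in L^2(\mathbb{R})\}$ be the standard momentum operator in $L^2(\mathbb{R},dt)$. Then: 1. $\partial_c$ is an unbounded normal operator on $\mathbb{H}_c$: it is not bounded on its domain, it is densely defined and closed, and $\partial_c^*\partial_c=\partial_c\partial_c^*$ (with equality of the natural domains of the two products). 2. $D(\partial_c^*)=D(\partial_c)$ and $\partial_c^*=2c-\partial_c$.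 3. $\partial_c=c+iV_c$ and $D(V_c)=D(\partial_c)$, where $\operatorname{Re}(\partial_c):=\frac12(\partial_c+\partial_c^*)=c$ on $D(\partial_c)$ and $\operatorname{Im}(\partial_c):=\frac1{2i}(\partial_c-\partial_c^*)=V_c$; moreover, $V_c$ is an unbounded self-adjoint operator. 4. $V_c$ is unitarily equivalent to the momentum operator: the map $(Wf)(t)=e^{-ct}f(t)$ is unitary from $\mathbb{H}_c$ onto $L^2(\mathbb{R},dt)$, and $WV_cW^{-1}=V_0$ (equality of domains included). -/

import Mathlib

open MeasureTheory

noncomputable section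

namespace InfShift

/-! ### Unbounded operators: products, scalars, normality, unitary conjugation -/

section Operators

variable {E F : Type*} [NormedAddCommGroup E] [InnerProductSpace ℂ E]
  [NormedAddCommGroup F] [InnerProductSpace ℂ F]

/-- The product `S T` of two unbounded operators, on its natural (maximal) domain
`{x ∈ D(T) | T x ∈ D(S)}`. -/
def opMul (S T : E →ₗ.[ℂ] E) : E →ₗ.[ℂ] E where
  domain :=
    { carrier := {x | ∃ hx : x ∈ T.domain, T ⟨x, hx⟩ ∈ S.domain}
      zero_mem' := ⟨T.domain.zero_mem, by
        have h : T ⟨0, T.domain.zero_mem⟩ = 0 := T.map_zero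
        rw [h]; exact S.domain.zero_mem⟩
      add_mem' := by
        rintro x y ⟨hx, hx'⟩ ⟨hy, hy'⟩
        refine ⟨T.domain.add_mem hx hy, ?_⟩
        have h := T.map_add ⟨x, hx⟩ ⟨y, hy⟩
        have h' : T ⟨x + y, T.domain.add_mem hx hy⟩ = T ⟨x, hx⟩ + T ⟨y, hy⟩ := h
        rw [h']; exact S.domain.add_mem hx' hy'
      smul_mem' := by
        rintro a x ⟨hx, hx'⟩
        refine ⟨T.domain.smul_mem a hx, ?_⟩
        have h' : T ⟨a • x, T.domain.smul_mem a hx⟩ = a • T ⟨x, hx⟩ := T.map_smul a ⟨x, hx⟩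
        rw [h']; exact S.domain.smul_mem a hx' }
  toFun :=
    { toFun := fun x => S ⟨T ⟨x.1, x.2.1⟩, x.2.2⟩
      map_add' := by
        rintro ⟨x, hx, hx'⟩ ⟨y, hy, hy'⟩
        have h' : T ⟨x + y, T.domain.add_mem hx hy⟩ = T ⟨x, hx⟩ + T ⟨y, hy⟩ :=
          T.map_add ⟨x, hx⟩ ⟨y, hy⟩
        rw [← S.map_add]
        exact congrArg S (Subtype.ext h')
      map_smul' := by
        rintro a ⟨x, hx, hx'⟩
        have h' : T ⟨a • x, T.domain.smul_mem a hx⟩ = a • T ⟨x, hx⟩ := T.map_smul a ⟨x, hx⟩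
        rw [RingHom.id_apply, ← S.map_smul]
        exact congrArg S (Subtype.ext h') }

/-- The scalar `z`, i.e. `z` times the identity operator, with domain `p`. -/
def scalarOn (z : ℂ) (p : Submodule ℂ E) : E →ₗ.[ℂ] E :=
  (z • (LinearMap.id : E →ₗ[ℂ] E)).toPMap p

/-- `T` is unbounded: no constant `C` satisfies `‖T x‖ ≤ C ‖x‖` on the domain. -/
def IsUnboundedOp (T : E →ₗ.[ℂ] E) : Prop :=
  ¬ ∃ C : ℝ, ∀ x : T.domain, ‖T x‖ ≤ C * ‖(x : E)‖

/-- `T` is a (possibly unbounded) normal operator: densely defined, closed, and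
`T* T = T T*`, equality of domains included. -/
def IsNormalOp [CompleteSpace E] (T : E →ₗ.[ℂ] E) : Prop :=
  Dense (T.domain : Set E) ∧ T.IsClosed ∧ opMul T.adjoint T = opMul T T.adjoint

/-- The real part `(T + T*) / 2`, with domain `D(T) ∩ D(T*)`. -/
def reOp [CompleteSpace E] (T : E →ₗ.[ℂ] E) : E →ₗ.[ℂ] E :=
  (1 / 2 : ℂ) • (T + T.adjoint)

/-- The imaginary part `(T - T*) / (2 i)`, with domain `D(T) ∩ D(T*)`. -/
def imOp [CompleteSpace E] (T : E →ₗ.[ℂ] E) : E →ₗ.[ℂ] E :=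
  (1 / (2 * Complex.I) : ℂ) • (T - T.adjoint)

/-- The operator `W T W⁻¹`, with domain `{y | W⁻¹ y ∈ D(T)} = W (D(T))`. -/
def unitaryConj (W : E ≃ₗᵢ[ℂ] F) (T : E →ₗ.[ℂ] E) : F →ₗ.[ℂ] F where
  domain := T.domain.comap (W.symm.toLinearEquiv : F →ₗ[ℂ] E)
  toFun :=
    { toFun := fun y => W (T ⟨W.symm y.1, y.2⟩)
      map_add' := by
        rintro ⟨x, hx⟩ ⟨y, hy⟩
        rw [← W.map_add, ← T.map_add]
        exact congrArg (fun z => W (T z)) (Subtype.ext (W.symm.map_add x y))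
      map_smul' := by
        rintro a ⟨x, hx⟩
        rw [RingHom.id_apply, ← W.map_smul, ← T.map_smul]
        exact congrArg (fun z => W (T z)) (Subtype.ext (W.symm.map_smul a x)) }

end Operators

/-! ### Differentiation on `L²(ℝ, μ)` -/

/-- (Locally) absolutely continuous functions on `ℝ`: absolutely continuous on every compact
interval. -/
def LocAC (g : ℝ → ℂ) : Prop :=
  ∀ a b : ℝ, AbsolutelyContinuousOnInterval g a b

theorem LocAC.continuous {g : ℝ → ℂ} (hg : LocAC g) : Continuous g := by
  rw [continuous_iff_continuousAt]
  intro x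
  have h := (hg (x - 1) (x + 1)).continuousOn
  rw [Set.uIcc_of_le (by linarith)] at h
  exact h.continuousAt (Icc_mem_nhds (by linarith) (by linarith))

theorem LocAC.ae_differentiableAt {g : ℝ → ℂ} (hg : LocAC g) :
    ∀ᵐ x : ℝ, DifferentiableAt ℝ g x := by
  have h : ∀ n : ℕ, ∀ᵐ x : ℝ, x ∈ Set.uIcc (-(n : ℝ)) n → DifferentiableAt ℝ g x :=
    fun n => (hg (-(n : ℝ)) n).boundedVariationOn.ae_differentiableAt_of_mem_uIcc
  filter_upwards [ae_all_iff.2 h] with x hx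
  obtain ⟨n, hn⟩ := exists_nat_ge |x|
  refine hx n ?_
  have := abs_le.1 hn
  rw [Set.uIcc_of_le (by linarith [abs_nonneg x])]
  exact this

theorem LocAC.add {g h : ℝ → ℂ} (hg : LocAC g) (hh : LocAC h) : LocAC (g + h) :=
  fun a b => (hg a b).add (hh a b)

theorem LocAC.smul {g : ℝ → ℂ} (z : ℂ) (hg : LocAC g) : LocAC (z • g) :=
  fun a b => (hg a b).const_smul z

variable {μ : Measure ℝ}

/-- The domain `{f ∈ L²(ℝ, μ) ∩ AC(ℝ) | f' ∈ L²(ℝ, μ)}`: the classes `f ∈ L²(ℝ, μ)` with an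
absolutely continuous representative `g` whose (a.e. defined) derivative is in `L²(ℝ, μ)`. -/
def derivDomain (hμ' : μ ≪ volume) : Submodule ℂ (Lp ℂ 2 μ) where
  carrier := {f | ∃ g : ℝ → ℂ, LocAC g ∧ f =ᵐ[μ] g ∧ MemLp (deriv g) 2 μ}
  zero_mem' := by
    refine ⟨0, fun a b => ?_, Lp.coeFn_zero ℂ 2 μ, ?_⟩
    · exact (contDiff_const (c := (0 : ℂ))).contDiffOn.absolutelyContinuousOnInterval
    · rw [deriv_zero]; exact MemLp.zero
  add_mem' := by
    rintro f₁ f₂ ⟨g₁, h₁, e₁, m₁⟩ ⟨g₂, h₂, e₂, m₂⟩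
    refine ⟨g₁ + g₂, h₁.add h₂, (Lp.coeFn_add f₁ f₂).trans (e₁.add e₂), ?_⟩
    refine (memLp_congr_ae ?_).2 (m₁.add m₂)
    filter_upwards [hμ'.ae_le h₁.ae_differentiableAt, hμ'.ae_le h₂.ae_differentiableAt]
      with x hx₁ hx₂
    exact deriv_add hx₁ hx₂
  smul_mem' := by
    rintro z f ⟨g, h, e, m⟩
    refine ⟨z • g, h.smul z, (Lp.coeFn_smul z f).trans (e.const_smul z), ?_⟩
    refine (memLp_congr_ae ?_).2 (m.const_smul z)
    filter_upwards [hμ'.ae_le h.ae_differentiableAt] with x hx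
    exact deriv_const_smul z hx

/-- The absolutely continuous representative is unique when `μ` dominates Lebesgue measure. -/
theorem LocAC.eq_of_ae_eq (hμ : volume ≪ μ) {g h : ℝ → ℂ} (hg : LocAC g) (hh : LocAC h)
    (e : g =ᵐ[μ] h) : g = h :=
  Continuous.ae_eq_iff_eq (μ := (volume : Measure ℝ)) hg.continuous hh.continuous |>.1
    (hμ.ae_le e)

/-- The differentiation operator `f ↦ f'` in `L²(ℝ, μ)` on the domain `derivDomain`, for a measure
`μ` with the same null sets as Lebesgue measure. -/
def derivOp (hμ : volume ≪ μ) (hμ' : μ ≪ volume) : Lp ℂ 2 μ →ₗ.[ℂ] Lp ℂ 2 μ where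
  domain := derivDomain hμ'
  toFun :=
    { toFun := fun f => f.2.choose_spec.2.2.toLp (deriv f.2.choose)
      map_add' := by
        intro f₁ f₂
        obtain ⟨h, e, m⟩ := (f₁ + f₂).2.choose_spec
        obtain ⟨h₁, e₁, m₁⟩ := f₁.2.choose_spec
        obtain ⟨h₂, e₂, m₂⟩ := f₂.2.choose_spec
        have key : (f₁ + f₂).2.choose = f₁.2.choose + f₂.2.choose :=
          h.eq_of_ae_eq hμ (h₁.add h₂)
            (e.symm.trans ((Lp.coeFn_add f₁.1 f₂.1).trans (e₁.add e₂)))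
        rw [← MemLp.toLp_add, MemLp.toLp_eq_toLp_iff, key]
        filter_upwards [hμ'.ae_le h₁.ae_differentiableAt, hμ'.ae_le h₂.ae_differentiableAt]
          with x hx₁ hx₂
        exact deriv_add hx₁ hx₂
      map_smul' := by
        intro z f
        obtain ⟨h', e', m'⟩ := (z • f).2.choose_spec
        obtain ⟨h, e, m⟩ := f.2.choose_spec
        have key : (z • f).2.choose = z • f.2.choose :=
          h'.eq_of_ae_eq hμ (h.smul z)
            (e'.symm.trans ((Lp.coeFn_smul z f.1).trans (e.const_smul z)))
        rw [RingHom.id_apply, ← MemLp.toLp_const_smul, MemLp.toLp_eq_toLp_iff, key]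
        filter_upwards [hμ'.ae_le h.ae_differentiableAt] with x hx
        exact deriv_const_smul z hx }

/-- `derivOp` sends `f` to the a.e. derivative of any absolutely continuous representative. -/
theorem derivOp_ae_eq (hμ : volume ≪ μ) (hμ' : μ ≪ volume) (f : (derivOp hμ hμ').domain)
    {g : ℝ → ℂ} (hg : LocAC g) (e : (f : Lp ℂ 2 μ) =ᵐ[μ] g) :
    derivOp hμ hμ' f =ᵐ[μ] deriv g := by
  obtain ⟨h₁, e₁, m₁⟩ := f.2.choose_spec
  have key : f.2.choose = g := h₁.eq_of_ae_eq hμ hg (e₁.symm.trans e)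
  exact m₁.coeFn_toLp.trans (by rw [key])

/-! ### The weighted space `ℍ_c = L²(ℝ, e^{-2ct} dt)` and the infinitesimal shift -/

/-- The measure `μ_c(dt) = e^{-2ct} dt`. -/
def weight (c : ℝ) : Measure ℝ :=
  volume.withDensity fun t => ENNReal.ofReal (Real.exp (-2 * c * t))

theorem weight_ac (c : ℝ) : weight c ≪ volume :=
  withDensity_absolutelyContinuous _ _

theorem ac_weight (c : ℝ) : volume ≪ weight c :=
  withDensity_absolutelyContinuous' (by fun_prop)
    (Filter.Eventually.of_forall fun t => by simp [Real.exp_pos])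

/-- The complex Hilbert space `ℍ_c = L²(ℝ, e^{-2ct} dt)`. -/
abbrev Hc (c : ℝ) : Type := Lp ℂ 2 (weight c)

/-- The infinitesimal shift `∂_c = d/dt` in `ℍ_c`, with domain
`{f ∈ ℍ_c ∩ AC(ℝ) | f' ∈ ℍ_c}`. -/
def shift (c : ℝ) : Hc c →ₗ.[ℂ] Hc c := derivOp (ac_weight c) (weight_ac c)

/-- The operator `V_c = (∂_c - c) / i`. -/
def Vop (c : ℝ) : Hc c →ₗ.[ℂ] Hc c :=
  (1 / Complex.I : ℂ) • (shift c - scalarOn (c : ℂ) (shift c).domain)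

/-- The standard momentum operator `(1/i) d/dt` in `L²(ℝ, dt)`, with domain
`{f ∈ L²(ℝ) ∩ AC(ℝ) | f' ∈ L²(ℝ)}`. -/
def momentum : Lp ℂ 2 (volume : Measure ℝ) →ₗ.[ℂ] Lp ℂ 2 (volume : Measure ℝ) :=
  (1 / Complex.I : ℂ) •
    derivOp (μ := (volume : Measure ℝ)) Measure.AbsolutelyContinuous.rfl
      Measure.AbsolutelyContinuous.rfl

end InfShift

end

open InfShift

/-! Everything follows from the product rule `(e^{-ct} f)' = e^{-ct} (f' - c f)`: multiplication by
`e^{-ct}` is a unitary `W` that carries `V_c` onto the momentum operator, domains included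
(`lineDeriv_expUnitary`, `unitaryConj_expUnitary_Vop`). So `V_c` is self-adjoint once momentum is.

Momentum is symmetric by integration by parts (`inner_lineDeriv_left`). It is maximal because an
element of the adjoint's domain has a weak derivative in `L²`, hence an absolutely continuous
representative (`mem_lineDeriv_domain_of_weak_deriv`, a du Bois-Reymond argument).

The rest is algebra for any `T = c + iV` with `V` self-adjoint: `T* = c - iV = 2c - T`, which has
the domain of `T` and commutes with `T`, so `T` is normal with real part `c` and imaginary part `V`.
Unboundedness is by contraposition: a bounded operator has an everywhere defined adjoint, whereas
the adjoint domains here equal `D(∂_c)`, which is proper because a jump function is not absolutely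
continuous. -/

namespace InfShift

open scoped ComplexConjugate InnerProductSpace
open LinearPMap

/-! ### Adjoints of unbounded operators -/

section Operators

variable {E F : Type*} [NormedAddCommGroup E] [InnerProductSpace ℂ E]
  [NormedAddCommGroup F] [InnerProductSpace ℂ F]

theorem unitaryConj_apply (W : E ≃ₗᵢ[ℂ] F) (T : E →ₗ.[ℂ] E) (y : (unitaryConj W T).domain) :
    unitaryConj W T y = W (T ⟨W.symm y, y.2⟩) := rfl

variable [CompleteSpace E] [CompleteSpace F]

/-- A densely defined symmetric operator whose domain contains that of its adjoint is
self-adjoint. -/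
theorem isSelfAdjoint_of_symmetric {T : E →ₗ.[ℂ] E} (hd : Dense (T.domain : Set E))
    (hs : T.IsFormalAdjoint T)
    (hm : ∀ y z : E, (∀ x : T.domain, ⟪z, (x : E)⟫_ℂ = ⟪y, T x⟫_ℂ) → y ∈ T.domain) :
    IsSelfAdjoint T := by
  rw [isSelfAdjoint_def]
  have hle := hs.le_adjoint hd
  refine (eq_of_le_of_domain_eq hle (le_antisymm hle.1 fun y hy => ?_)).symm
  exact hm y (T.adjoint ⟨y, hy⟩) fun x => adjoint_isFormalAdjoint hd ⟨y, hy⟩ x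

/-- Self-adjointness can be checked after conjugation by a unitary. -/
theorem isSelfAdjoint_of_unitaryConj (W : E ≃ₗᵢ[ℂ] F) {T : E →ₗ.[ℂ] E}
    (h : IsSelfAdjoint (unitaryConj W T)) : IsSelfAdjoint T := by
  have hW : ∀ x ∈ T.domain, W x ∈ (unitaryConj W T).domain := fun x hx => by
    change W.symm (W x) ∈ T.domain
    rwa [W.symm_apply_apply]
  have hWT : ∀ x : T.domain, unitaryConj W T ⟨W x, hW x x.2⟩ = W (T x) := fun x => by
    rw [unitaryConj_apply]
    exact congrArg (fun z => W (T z)) (Subtype.ext (W.symm_apply_apply (x : E)))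
  have hf := adjoint_isFormalAdjoint h.dense_domain
  rw [isSelfAdjoint_def.1 h] at hf
  refine isSelfAdjoint_of_symmetric ?_ (fun x y => ?_) fun y z hyz => ?_
  · have := W.symm.surjective.denseRange.dense_image W.symm.continuous h.dense_domain
    refine this.mono ?_
    rintro _ ⟨y, hy, rfl⟩
    exact hy
  · have := hf ⟨W x, hW x x.2⟩ ⟨W y, hW y y.2⟩
    rwa [hWT, hWT, W.inner_map_map, W.inner_map_map] at this
  · have : W y ∈ (unitaryConj W T).domain := by
      rw [← isSelfAdjoint_def.1 h]
      refine mem_adjoint_domain_of_exists _ ⟨W z, fun x => ?_⟩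
      rw [unitaryConj_apply, W.inner_map_map, ← hyz ⟨W.symm x, x.2⟩, ← W.inner_map_map z,
        W.apply_symm_apply]
    have h2 : W.symm (W y) ∈ T.domain := this
    rwa [W.symm_apply_apply] at h2

/-- The adjoint of `z + a T` is `conj z + conj a T*` if `a ≠ 0`. -/
theorem adjoint_scalarOn_add_smul {T : E →ₗ.[ℂ] E} (hd : Dense (T.domain : Set E)) (z : ℂ) {a : ℂ}
    (ha : a ≠ 0) :
    (scalarOn z T.domain + a • T).adjoint
      = scalarOn (conj z) T.adjoint.domain + conj a • T.adjoint := by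
  have hdom : (scalarOn z T.domain + a • T).domain = T.domain := inf_idem _
  have hdom' : (scalarOn (conj z) T.adjoint.domain + conj a • T.adjoint).domain
      = T.adjoint.domain := inf_idem _
  have hd' : Dense ((scalarOn z T.domain + a • T).domain : Set E) := by rwa [hdom]
  have hle : scalarOn (conj z) T.adjoint.domain + conj a • T.adjoint
      ≤ (scalarOn z T.domain + a • T).adjoint := by
    refine IsFormalAdjoint.le_adjoint hd' fun x y => ?_
    have h := adjoint_isFormalAdjoint hd ⟨y, y.2.1⟩ ⟨x, x.2.1⟩
    have e₁ : (scalarOn z T.domain + a • T) x = z • (x : E) + a • T ⟨x, x.2.1⟩ := rfl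
    have e₂ : (scalarOn (conj z) T.adjoint.domain + conj a • T.adjoint) y
      = conj z • (y : E) + conj a • T.adjoint ⟨y, y.2.1⟩ := rfl
    have h' : ⟪T ⟨x, x.2.1⟩, (y : E)⟫_ℂ = ⟪(x : E), T.adjoint ⟨y, y.2.1⟩⟫_ℂ := by
      rw [← inner_conj_symm, ← h, inner_conj_symm]
    rw [e₁, e₂, inner_add_left, inner_add_right, inner_smul_left, inner_smul_left,
      inner_smul_right, inner_smul_right, h']
  refine (eq_of_le_of_domain_eq hle (le_antisymm hle.1 fun y hy => ?_)).symm
  rw [hdom']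
  -- The witness solves `(z + a T)* y = conj z • y + conj a • T* y` for `T* y`; this is where `a ≠
  -- 0` is needed.
  refine mem_adjoint_domain_of_exists _
    ⟨(conj a)⁻¹ • ((scalarOn z T.domain + a • T).adjoint ⟨y, hy⟩ - conj z • y), fun x => ?_⟩
  have h := adjoint_isFormalAdjoint hd' ⟨y, hy⟩ ⟨x, x.2, x.2⟩
  have e₁ : (scalarOn z T.domain + a • T) ⟨x, x.2, x.2⟩ = z • (x : E) + a • T x := rfl
  rw [e₁, inner_add_right, inner_smul_right, inner_smul_right] at h
  rw [inner_smul_left, inner_sub_left, inner_smul_left, h]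
  simp only [map_inv₀, Complex.conj_conj]
  field_simp
  ring

/-- An operator whose adjoint is not everywhere defined is unbounded. -/
theorem isUnboundedOp_of_adjoint_domain_ne_top {T : E →ₗ.[ℂ] E} (h : T.adjoint.domain ≠ ⊤) :
    IsUnboundedOp T := by
  rintro ⟨C, hC⟩
  refine h (Submodule.eq_top_iff'.2 fun y => ?_)
  rw [mem_adjoint_domain_iff]
  exact (innerSL ℂ y).continuous.comp (T.toFun.mkContinuous C hC).continuous

end Operators

/-! ### Operators `c + iV` with `V` self-adjoint -/

section RealPlusImaginary

variable {E : Type*} [NormedAddCommGroup E] [InnerProductSpace ℂ E]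

/-- The operator `(T - c) / i`. -/
noncomputable def imPart (T : E →ₗ.[ℂ] E) (c : ℝ) : E →ₗ.[ℂ] E :=
  (1 / Complex.I : ℂ) • (T - scalarOn (c : ℂ) T.domain)

variable {T : E →ₗ.[ℂ] E} {c : ℝ}

theorem imPart_domain (T : E →ₗ.[ℂ] E) (c : ℝ) : (imPart T c).domain = T.domain := inf_idem _

theorem imPart_apply (x : (imPart T c).domain) :
    imPart T c x = (1 / Complex.I : ℂ) • (T ⟨x, x.2.1⟩ - (c : ℂ) • (x : E)) := rfl

theorem eq_scalarOn_add_imPart (T : E →ₗ.[ℂ] E) (c : ℝ) :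
    T = scalarOn (c : ℂ) T.domain + Complex.I • imPart T c := by
  refine LinearPMap.ext ?_ fun x hx hx' => ?_
  · rw [LinearPMap.add_domain, LinearPMap.smul_domain, imPart_domain]
    exact (inf_idem _).symm
  change _ = (c : ℂ) • x + Complex.I • (1 / Complex.I : ℂ) • (T ⟨x, hx⟩ - (c : ℂ) • x)
  rw [smul_smul, mul_one_div_cancel Complex.I_ne_zero, one_smul, add_sub_cancel]

variable [CompleteSpace E]

theorem dense_domain_of_imPart (hV : IsSelfAdjoint (imPart T c)) : Dense (T.domain : Set E) :=
  imPart_domain T c ▸ hV.dense_domain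

theorem adjoint_eq_scalarOn_add_imPart (hV : IsSelfAdjoint (imPart T c)) :
    T.adjoint = scalarOn (c : ℂ) T.domain + (-Complex.I) • imPart T c := by
  have h := adjoint_scalarOn_add_smul hV.dense_domain (c : ℂ) Complex.I_ne_zero
  rw [LinearPMap.isSelfAdjoint_def.1 hV, imPart_domain, ← eq_scalarOn_add_imPart,
    Complex.conj_ofReal, Complex.conj_I] at h
  exact h

theorem adjoint_domain_of_imPart (hV : IsSelfAdjoint (imPart T c)) :
    T.adjoint.domain = T.domain := by
  rw [adjoint_eq_scalarOn_add_imPart hV, LinearPMap.add_domain, LinearPMap.smul_domain,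
    imPart_domain]
  exact inf_idem _

/-- If `(T - c) / i` is self-adjoint, then the adjoint of `T` is `2c - T`. -/
theorem adjoint_eq_scalarOn_sub (hV : IsSelfAdjoint (imPart T c)) :
    T.adjoint = scalarOn (2 * c : ℂ) T.domain - T := by
  rw [adjoint_eq_scalarOn_add_imPart hV]
  refine LinearPMap.ext ?_ fun x hx hx' => ?_
  · rw [LinearPMap.add_domain, LinearPMap.smul_domain, imPart_domain]
    rfl
  change (c : ℂ) • x + (-Complex.I) • (1 / Complex.I : ℂ) • (T ⟨x, hx.1⟩ - (c : ℂ) • x)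
    = (2 * c : ℂ) • x - T ⟨x, hx.1⟩
  rw [smul_smul, neg_mul, mul_one_div_cancel Complex.I_ne_zero, neg_one_smul, two_mul, add_smul]
  abel

/-- Taking the adjoint of `c - iV` gives back `c + iV`. This yields closedness of `T`, since
adjoints are closed. -/
theorem adjoint_adjoint_of_imPart (hV : IsSelfAdjoint (imPart T c)) : T.adjoint.adjoint = T := by
  have h := adjoint_scalarOn_add_smul hV.dense_domain (c : ℂ) (neg_ne_zero.2 Complex.I_ne_zero)
  rw [LinearPMap.isSelfAdjoint_def.1 hV, imPart_domain, ← adjoint_eq_scalarOn_add_imPart hV,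
    Complex.conj_ofReal, _root_.map_neg, Complex.conj_I, neg_neg, ← eq_scalarOn_add_imPart] at h
  exact h

theorem adjoint_apply_of_imPart (hV : IsSelfAdjoint (imPart T c)) (x : T.adjoint.domain)
    (hx : (x : E) ∈ T.domain) : T.adjoint x = (2 * c : ℂ) • (x : E) - T ⟨x, hx⟩ :=
  (LinearPMap.ext_iff.1 (adjoint_eq_scalarOn_sub hV)).2 (hf := x.2) (hg := ⟨hx, hx⟩)

theorem isNormalOp_of_imPart (hV : IsSelfAdjoint (imPart T c)) : IsNormalOp T := by
  have hd := dense_domain_of_imPart hV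
  have hD := adjoint_domain_of_imPart hV
  refine ⟨hd, ?_, ?_⟩
  · rw [← adjoint_adjoint_of_imPart hV]
    exact LinearPMap.adjoint_isClosed (by rwa [hD])
  have hmem : ∀ x, x ∈ T.adjoint.domain ↔ x ∈ T.domain := fun x => by rw [hD]
  have hiff : ∀ (x : E) (hx : x ∈ T.domain) (hx' : x ∈ T.adjoint.domain),
      T.adjoint ⟨x, hx'⟩ ∈ T.domain ↔ T ⟨x, hx⟩ ∈ T.domain := by
    intro x hx hx'
    rw [adjoint_apply_of_imPart hV ⟨x, hx'⟩ hx]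
    -- `T* x = 2c x - T x` and `2c x` already lies in the domain, so `T* x` lies there exactly when
    -- `T x` does.
    exact Submodule.sub_mem_iff_right _ (Submodule.smul_mem _ _ hx)
  refine LinearPMap.ext (SetLike.ext fun x => ⟨?_, ?_⟩) ?_
  · rintro ⟨hx, h⟩
    exact ⟨(hmem x).2 hx, (hiff x hx _).2 ((hmem _).1 h)⟩
  · rintro ⟨hx, h⟩
    exact ⟨(hmem x).1 hx, (hmem _).2 ((hiff x ((hmem x).1 hx) hx).1 h)⟩
  · rintro x ⟨hx, h⟩ ⟨hx', h'⟩
    change T.adjoint ⟨T ⟨x, hx⟩, h⟩ = T ⟨T.adjoint ⟨x, hx'⟩, h'⟩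
    have h₁ : T ⟨x, hx⟩ ∈ T.domain := (hmem _).1 h
    have e : (⟨T.adjoint ⟨x, hx'⟩, h'⟩ : T.domain)
        = (2 * c : ℂ) • ⟨x, hx⟩ - ⟨T ⟨x, hx⟩, h₁⟩ :=
      Subtype.ext (adjoint_apply_of_imPart hV ⟨x, hx'⟩ hx)
    -- Both products send `x` to `2c T x - T (T x)`.
    rw [e, LinearPMap.map_sub, LinearPMap.map_smul, adjoint_apply_of_imPart hV _ h₁]

theorem reOp_eq_scalarOn (hV : IsSelfAdjoint (imPart T c)) :
    reOp T = scalarOn (c : ℂ) T.domain := by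
  refine LinearPMap.ext ?_ fun x hx hx' => ?_
  · change T.domain ⊓ T.adjoint.domain = T.domain
    rw [adjoint_domain_of_imPart hV, inf_idem]
  · change (1 / 2 : ℂ) • (T ⟨x, hx.1⟩ + T.adjoint ⟨x, hx.2⟩) = (c : ℂ) • x
    rw [adjoint_apply_of_imPart hV _ hx.1, add_sub_cancel, smul_smul]
    congr 1
    ring

theorem imOp_eq_imPart (hV : IsSelfAdjoint (imPart T c)) : imOp T = imPart T c := by
  refine LinearPMap.ext ?_ fun x hx hx' => ?_
  · change T.domain ⊓ T.adjoint.domain = (imPart T c).domain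
    rw [adjoint_domain_of_imPart hV, inf_idem, imPart_domain]
  · change (1 / (2 * Complex.I) : ℂ) • (T ⟨x, hx.1⟩ - T.adjoint ⟨x, hx.2⟩) =
      (1 / Complex.I : ℂ) • (T ⟨x, hx.1⟩ - (c : ℂ) • x)
    rw [adjoint_apply_of_imPart hV _ hx.1]
    have : T ⟨x, hx.1⟩ - ((2 * c : ℂ) • x - T ⟨x, hx.1⟩)
        = (2 : ℂ) • (T ⟨x, hx.1⟩ - (c : ℂ) • x) := by
      rw [smul_sub, smul_smul, two_smul]
      abel
    rw [this, smul_smul]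
    congr 1
    field_simp

end RealPlusImaginary

end InfShift

namespace InfShift

open scoped ComplexConjugate InnerProductSpace Topology
open Filter Set

/-! ### Locally absolutely continuous functions and integration by parts -/

section AbsolutelyContinuous

theorem LocAC.mul {g h : ℝ → ℂ} (hg : LocAC g) (hh : LocAC h) : LocAC (g * h) :=
  fun a b => (hg a b).smul (hh a b)

theorem LocAC.conj {g : ℝ → ℂ} (hg : LocAC g) : LocAC fun x => conj (g x) := fun a b => by
  have h := hg a b
  unfold AbsolutelyContinuousOnInterval at h ⊢
  simpa [Complex.dist_conj_conj] using h

theorem LocAC.of_contDiff {g : ℝ → ℂ} (hg : ContDiff ℝ 1 g) : LocAC g :=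
  fun _ _ => hg.contDiffOn.absolutelyContinuousOnInterval

theorem locAC_const (z : ℂ) : LocAC fun _ => z := .of_contDiff contDiff_const

/-- The primitives of a locally integrable function are locally absolutely continuous. -/
theorem locAC_integral {f : ℝ → ℂ} (hf : LocallyIntegrable f) (c : ℝ) :
    LocAC fun x => ∫ t in c..x, f t := by
  intro a b
  have hi : ∀ u v, IntervalIntegrable f volume u v := fun u v =>
    (hf.integrableOn_isCompact isCompact_uIcc).intervalIntegrable
  -- The interval is enlarged to contain the base point `c` of the primitive, and the result
  -- restricted to `[a, b]` at the end.
  have hsub : uIcc a b ⊆ uIcc (min c (min a b)) (max c (max a b)) := by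
    intro x hx
    rw [uIcc, mem_Icc] at hx
    rw [uIcc_of_le ((min_le_left _ _).trans (le_max_left _ _)), mem_Icc]
    exact ⟨(min_le_right _ _).trans hx.1, hx.2.trans (le_max_right _ _)⟩
  have hc : c ∈ uIcc (min c (min a b)) (max c (max a b)) := by
    rw [uIcc_of_le ((min_le_left _ _).trans (le_max_left _ _)), mem_Icc]
    exact ⟨min_le_left _ _, le_max_left _ _⟩
  have hi' := hi (min c (min a b)) (max c (max a b))
  have hre : IntervalIntegrable (fun t => (f t).re) volume (min c (min a b)) (max c (max a b)) :=
    ⟨hi'.1.re, hi'.2.re⟩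
  have him : IntervalIntegrable (fun t => (f t).im) volume (min c (min a b)) (max c (max a b)) :=
    ⟨hi'.1.im, hi'.2.im⟩
  -- The real and imaginary parts have real primitives; scaling the constants `1` and `i` by them
  -- makes them complex-valued, and their sum is the primitive of `f`.
  have h₁ := (hre.absolutelyContinuousOnInterval_intervalIntegral hc).smul
    (locAC_const 1 (min c (min a b)) (max c (max a b)))
  have h₂ := (him.absolutelyContinuousOnInterval_intervalIntegral hc).smul
    (locAC_const Complex.I (min c (min a b)) (max c (max a b)))
  convert! (h₁.add h₂).mono hsub using 1
  funext x
  have e₁ : ∫ t in c..x, (f t).re = (∫ t in c..x, f t).re :=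
    intervalIntegral.intervalIntegral_eq_integral_uIoc f c x volume ▸ by
      rw [intervalIntegral.intervalIntegral_eq_integral_uIoc, Complex.smul_re]
      congr 1
      exact integral_re ((intervalIntegrable_iff.1 (hi c x)))
  have e₂ : ∫ t in c..x, (f t).im = (∫ t in c..x, f t).im :=
    intervalIntegral.intervalIntegral_eq_integral_uIoc f c x volume ▸ by
      rw [intervalIntegral.intervalIntegral_eq_integral_uIoc, Complex.smul_im]
      congr 1
      exact integral_im ((intervalIntegrable_iff.1 (hi c x)))
  simp only [Pi.add_apply, Pi.smul_apply', e₁, e₂]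
  apply Complex.ext <;> simp

/-- The fundamental theorem of calculus for complex-valued locally absolutely continuous
functions. -/
theorem LocAC.integral_deriv {h : ℝ → ℂ} (hh : LocAC h) (hi : LocallyIntegrable (deriv h))
    (a b : ℝ) : ∫ t in a..b, deriv h t = h b - h a := by
  have hG := locAC_integral hi a
  have hd : ∀ᵐ x, x ∈ uIcc a b → HasDerivAt (h - fun x => ∫ t in a..x, deriv h t) 0 x := by
    filter_upwards [hh.ae_differentiableAt, LocallyIntegrable.ae_hasDerivAt_integral hi] with x hx hx' _
    simpa using hx.hasDerivAt.sub (hx' a)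
  obtain ⟨C, hC⟩ := ((hh a b).sub (hG a b)).const_of_ae_hasDerivAt_zero hd
  have ha := hC a left_mem_uIcc
  have hb := hC b right_mem_uIcc
  simp only [Pi.sub_apply, intervalIntegral.integral_same, sub_zero] at ha hb
  rw [ha, ← hb]
  ring

/-- The derivative of an integrable locally absolutely continuous function has integral zero,
if it is integrable. -/
theorem LocAC.integral_deriv_eq_zero {h : ℝ → ℂ} (hh : LocAC h) (hi : Integrable h)
    (hi' : Integrable (deriv h)) : ∫ t, deriv h t = 0 := by
  have key := hh.integral_deriv hi'.locallyIntegrable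
  have htop : Tendsto h atTop (𝓝 (h 0 + ∫ t in Ioi 0, deriv h t)) := by
    have := (intervalIntegral_tendsto_integral_Ioi 0 hi'.integrableOn tendsto_id).const_add (h 0)
    refine this.congr fun x => ?_
    simp only [id, key]; ring
  have hbot : Tendsto h atBot (𝓝 (h 0 - ∫ t in Iic 0, deriv h t)) := by
    have := (intervalIntegral_tendsto_integral_Iic 0 hi'.integrableOn tendsto_id).const_sub (h 0)
    refine this.congr fun x => ?_
    simp only [id, key]; ring
  -- The limits exist because `h'` is integrable, and vanish because `h` is integrable while
  -- neighbourhoods of `±∞` have infinite measure.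
  have ztop := IntegrableAtFilter.eq_zero_of_tendsto (hi.integrableAtFilter atTop)
    (fun s hs => by
      obtain ⟨b, hb⟩ := mem_atTop_sets.1 hs
      rw [← top_le_iff, ← Real.volume_Ici (a := b)]
      exact measure_mono hb) htop
  have zbot := IntegrableAtFilter.eq_zero_of_tendsto (hi.integrableAtFilter atBot)
    (fun s hs => by
      obtain ⟨b, hb⟩ := mem_atBot_sets.1 hs
      rw [← top_le_iff, ← Real.volume_Iic (a := b)]
      exact measure_mono hb) hbot
  rw [← intervalIntegral.integral_Iic_add_Ioi hi'.integrableOn hi'.integrableOn (b := 0)]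
  linear_combination ztop - zbot

/-- Integration by parts on the line. -/
theorem LocAC.integral_mul_deriv_add {g h : ℝ → ℂ} (hg : LocAC g) (hh : LocAC h)
    (hi : Integrable (g * h)) (hi' : Integrable fun t => deriv g t * h t + g t * deriv h t) :
    ∫ t, (deriv g t * h t + g t * deriv h t) = 0 := by
  have e : deriv (g * h) =ᵐ[volume] fun t => deriv g t * h t + g t * deriv h t := by
    filter_upwards [hg.ae_differentiableAt, hh.ae_differentiableAt] with x hx hx'
    exact deriv_mul hx hx'
  rw [← integral_congr_ae e]
  exact (hg.mul hh).integral_deriv_eq_zero hi ((integrable_congr e).2 hi')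

theorem LocAC.deriv_conj {g : ℝ → ℂ} (hg : LocAC g) :
    ∀ᵐ x, deriv (fun t => conj (g t)) x = conj (deriv g x) := by
  filter_upwards [hg.ae_differentiableAt] with x hx
  exact (Complex.conjCLE.toContinuousLinearMap.hasFDerivAt.comp_hasDerivAt x hx.hasDerivAt).deriv

end AbsolutelyContinuous

end InfShift

namespace InfShift

open scoped ComplexConjugate InnerProductSpace Topology SchwartzMap
open Filter Set LinearPMap

/-! ### Self-adjointness of the momentum operator -/

section Momentum

/-- Differentiation in `L²(ℝ, dt)`. -/
noncomputable abbrev lineDeriv :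
    Lp ℂ 2 (volume : Measure ℝ) →ₗ.[ℂ] Lp ℂ 2 (volume : Measure ℝ) :=
  derivOp Measure.AbsolutelyContinuous.rfl Measure.AbsolutelyContinuous.rfl

theorem inner_eq_integral (f g : Lp ℂ 2 (volume : Measure ℝ)) :
    ⟪f, g⟫_ℂ = ∫ t, conj (f t) * g t := by
  rw [L2.inner_def]
  exact integral_congr_ae (.of_forall fun t => by simp [mul_comm])

theorem integrable_conj_mul {f g : ℝ → ℂ} (hf : MemLp f 2) (hg : MemLp g 2) :
    Integrable fun t => conj (f t) * g t :=
  hf.star.integrable_mul hg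

/-- Schwartz functions are dense in `L²` and belong to the domain. -/
theorem dense_lineDeriv_domain : Dense (lineDeriv.domain : Set (Lp ℂ 2 (volume : Measure ℝ))) := by
  refine (SchwartzMap.denseRange_toLpCLM (E := ℝ) (F := ℂ) (p := 2) (μ := volume)
    ENNReal.ofNat_ne_top).mono ?_
  rintro _ ⟨f, rfl⟩
  refine ⟨f, .of_contDiff (f.smooth 1), f.coeFn_toLp 2 volume, ?_⟩
  exact (SchwartzMap.derivCLM ℝ ℂ f).memLp 2 volume

/-- Differentiation is skew-symmetric. -/
theorem inner_lineDeriv_left (f g : lineDeriv.domain) :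
    ⟪lineDeriv f, (g : Lp ℂ 2 (volume : Measure ℝ))⟫_ℂ = -⟪(f : Lp ℂ 2 volume), lineDeriv g⟫_ℂ := by
  obtain ⟨u, hu, eu, mu⟩ := f.2
  obtain ⟨v, hv, ev, mv⟩ := g.2
  have du := derivOp_ae_eq _ _ f hu eu
  have dv := derivOp_ae_eq _ _ g hv ev
  have mu₀ : MemLp u 2 := (memLp_congr_ae eu).1 (Lp.memLp _)
  have mv₀ : MemLp v 2 := (memLp_congr_ae ev).1 (Lp.memLp _)
  have i₁ := integrable_conj_mul mu mv₀
  have i₂ := integrable_conj_mul mu₀ mv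
  have e : (fun t => deriv (fun s => conj (u s)) t * v t + conj (u t) * deriv v t)
      =ᵐ[volume] fun t => conj (deriv u t) * v t + conj (u t) * deriv v t := by
    filter_upwards [hu.deriv_conj] with t ht
    rw [ht]
  have key := hu.conj.integral_mul_deriv_add hv (integrable_conj_mul mu₀ mv₀)
    ((integrable_congr e).2 (i₁.add i₂))
  rw [integral_congr_ae e, integral_add i₁ i₂] at key
  rw [inner_eq_integral, inner_eq_integral, eq_neg_iff_add_eq_zero, ← key]
  congr 1
  · refine integral_congr_ae ?_
    filter_upwards [du, ev] with t h₁ h₂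
    rw [h₁, h₂]
  · refine integral_congr_ae ?_
    filter_upwards [dv, eu] with t h₁ h₂
    rw [h₁, h₂]

/-- If `-z` is the weak derivative of `y`, then `y` plus a primitive of `z` is constant on every
bounded interval. -/
theorem exists_ae_eq_const_of_weak_deriv {y z : Lp ℂ 2 (volume : Measure ℝ)}
    (h : ∀ x : lineDeriv.domain, ⟪z, (x : Lp ℂ 2 volume)⟫_ℂ = ⟪y, lineDeriv x⟫_ℂ)
    {r : ℝ} (hr : 0 < r) :
    ∃ C : ℂ, ∀ᵐ t, t ∈ Ioc (-r) r → y t + ∫ s in (0 : ℝ)..t, z s = C := by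
  have hzl : LocallyIntegrable z := (Lp.memLp z).locallyIntegrable (by norm_num)
  set G : ℝ → ℂ := fun t => ∫ s in (0 : ℝ)..t, z s
  have hG : LocAC G := locAC_integral hzl 0
  have hGd : ∀ᵐ t, deriv G t = z t := by
    filter_upwards [LocallyIntegrable.ae_hasDerivAt_integral hzl] with t ht
    exact (ht 0).deriv
  set I : Set ℝ := Ioc (-r) r with hI
  have hIm : MeasurableSet I := measurableSet_Ioc
  have : IsFiniteMeasure (volume.restrict I) := ⟨by simp [hI]⟩
  have hGI : MemLp G 2 (volume.restrict I) := by
    obtain ⟨K, hK⟩ := isCompact_Icc.exists_bound_of_continuousOn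
      (hG.continuous.continuousOn (s := Icc (-r) r))
    refine MemLp.of_bound hG.continuous.aestronglyMeasurable K ?_
    exact (ae_restrict_iff' hIm).2 (.of_forall fun t ht => hK t (Ioc_subset_Icc_self ht))
  have huI : MemLp (fun t => y t + G t) 2 (volume.restrict I) :=
    ((Lp.memLp y).restrict I).add hGI
  -- `C` is the mean of `y + G` over `I`, so that `η` has integral zero and its primitive `φ`
  -- vanishes outside `[-r, r]`: `φ` is a legitimate test function.
  set C : ℂ := (2 * r : ℂ)⁻¹ * ∫ t in I, (y t + G t) with hC
  set η : ℝ → ℂ := I.indicator fun t => y t + G t - C with hη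
  have hηm : MemLp η 2 := (memLp_indicator_iff_restrict hIm).2 (huI.sub (memLp_const C))
  have hηi : Integrable η := (integrable_indicator_iff hIm).2
    ((huI.sub (memLp_const C)).integrable (by norm_num))
  have hη0 : ∫ t, η t = 0 := by
    rw [hη, integral_indicator hIm, integral_sub (huI.integrable (by norm_num))
      (integrable_const C), setIntegral_const, hC]
    have : (volume.real I : ℝ) = 2 * r := by
      rw [hI, Real.volume_real_Ioc_of_le (by linarith)]; ring
    rw [this, Complex.real_smul]
    have hr' : (r : ℂ) ≠ 0 := by exact_mod_cast hr.ne'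
    push_cast
    field_simp
    ring
  set φ : ℝ → ℂ := fun t => ∫ s in (-r)..t, η s with hφ
  have hφac : LocAC φ := locAC_integral hηi.locallyIntegrable _
  have hφd : ∀ᵐ t, deriv φ t = η t := by
    filter_upwards [LocallyIntegrable.ae_hasDerivAt_integral hηi.locallyIntegrable] with t ht
    exact (ht _).deriv
  have hφ0 : ∀ t, t ∉ Icc (-r) r → φ t = 0 := by
    intro t ht
    rw [mem_Icc, not_and_or, not_le, not_le] at ht
    rcases ht with ht | ht
    · refine intervalIntegral.integral_zero_ae (.of_forall fun s hs => ?_)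
      rw [uIoc_of_ge ht.le, mem_Ioc] at hs
      exact indicator_of_notMem (fun h' => absurd h'.1 (not_lt.2 hs.2)) _
    · rw [hφ, ← hη0]
      dsimp only
      rw [intervalIntegral.integral_of_le (by linarith)]
      refine setIntegral_eq_integral_of_forall_compl_eq_zero fun s hs => ?_
      exact indicator_of_notMem (fun h' => hs ⟨h'.1, h'.2.trans ht.le⟩) _
  have hφc : HasCompactSupport φ := HasCompactSupport.intro isCompact_Icc hφ0
  have hφm : MemLp φ 2 := hφac.continuous.memLp_of_hasCompactSupport hφc
  have hdom : hφm.toLp φ ∈ lineDeriv.domain :=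
    ⟨φ, hφac, hφm.coeFn_toLp, (memLp_congr_ae hφd).2 hηm⟩
  have hx := h ⟨hφm.toLp φ, hdom⟩
  rw [inner_eq_integral, inner_eq_integral] at hx
  have hxl : ∫ t, conj (z t) * (hφm.toLp φ) t = ∫ t, conj (z t) * φ t := by
    refine integral_congr_ae ?_
    filter_upwards [hφm.coeFn_toLp] with t ht
    rw [ht]
  have hxr : ∫ t, conj (y t) * lineDeriv ⟨hφm.toLp φ, hdom⟩ t = ∫ t, conj (y t) * η t := by
    refine integral_congr_ae ?_
    filter_upwards [derivOp_ae_eq _ _ ⟨hφm.toLp φ, hdom⟩ hφac hφm.coeFn_toLp, hφd] with t ht ht'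
    rw [ht, ht']
  rw [hxl, hxr] at hx
  have i₁ : Integrable fun t => conj (z t) * φ t := integrable_conj_mul (Lp.memLp z) hφm
  have i₂ : Integrable fun t => conj (G t) * η t := by
    have : Integrable (I.indicator fun t => conj (G t) * (y t + G t - C)) :=
      (integrable_indicator_iff hIm).2 (hGI.star.integrable_mul (huI.sub (memLp_const C)))
    refine this.congr (.of_forall fun t => ?_)
    exact indicator_mul_right I (fun t => conj (G t)) _
  have i₃ : Integrable fun t => conj (y t) * η t := integrable_conj_mul (Lp.memLp y) hηm
  have e : (fun t => deriv (fun s => conj (G s)) t * φ t + conj (G t) * deriv φ t)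
      =ᵐ[volume] fun t => conj (z t) * φ t + conj (G t) * η t := by
    filter_upwards [hG.deriv_conj, hGd, hφd] with t h₁ h₂ h₃
    rw [h₁, h₂, h₃]
  have key := hG.conj.integral_mul_deriv_add hφac
    ((hG.conj.continuous.mul hφac.continuous).integrable_of_hasCompactSupport
      hφc.mul_left) ((integrable_congr e).2 (i₁.add i₂))
  rw [integral_congr_ae e, integral_add i₁ i₂, hx] at key
  -- The weak relation and integration by parts give `∫ conj (y + G) η = 0`. Since also `∫ conj C η
  -- = 0`, the norm of `η` is zero.
  have hself : ⟪hηm.toLp η, hηm.toLp η⟫_ℂ = 0 := by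
    rw [inner_eq_integral]
    have : (fun t => conj ((hηm.toLp η) t) * (hηm.toLp η) t)
        =ᵐ[volume] fun t => (conj (y t) * η t + conj (G t) * η t) - conj C * η t := by
      filter_upwards [hηm.coeFn_toLp] with t ht
      rw [ht]
      by_cases htI : t ∈ I
      · have : η t = y t + G t - C := indicator_of_mem htI _
        rw [this]
        simp only [_root_.map_sub, _root_.map_add]
        ring
      · have : η t = 0 := indicator_of_notMem htI _
        simp [this]
    have i₄ : Integrable fun t => conj (y t) * η t + conj (G t) * η t := i₃.add i₂
    rw [integral_congr_ae this, integral_sub i₄ (hηi.const_mul _), integral_add i₃ i₂, key,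
      integral_const_mul, hη0]
    simp
  rw [inner_self_eq_zero] at hself
  refine ⟨C, ?_⟩
  have h0 := (Lp.eq_zero_iff_ae_eq_zero).1 hself
  filter_upwards [h0, hηm.coeFn_toLp] with t h₁ h₂ htI
  rw [h₁] at h₂
  have : η t = y t + G t - C := indicator_of_mem htI _
  rw [this] at h₂
  exact sub_eq_zero.1 h₂.symm

/-- A square integrable function with square integrable weak derivative is in the domain of
differentiation. -/
theorem mem_lineDeriv_domain_of_weak_deriv {y z : Lp ℂ 2 (volume : Measure ℝ)}
    (h : ∀ x : lineDeriv.domain, ⟪z, (x : Lp ℂ 2 volume)⟫_ℂ = ⟪y, lineDeriv x⟫_ℂ) :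
    y ∈ lineDeriv.domain := by
  have hzl : LocallyIntegrable z := (Lp.memLp z).locallyIntegrable (by norm_num)
  -- The radius `n + 1` is positive even for `n = 0`, and the half-open interval then contains every
  -- `t` with `|t| ≤ n`.
  choose C hC using fun n : ℕ =>
    exists_ae_eq_const_of_weak_deriv h (r := (n : ℝ) + 1) (by positivity)
  have hCn : ∀ n, C n = C 0 := by
    intro n
    -- All the intervals contain `(-1, 1]`, which has positive measure, so the constants can be
    -- compared at one of its points.
    have h₁ : ∀ᵐ t ∂volume.restrict (Ioc (-1 : ℝ) 1), C n = C 0 := by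
      rw [ae_restrict_iff' measurableSet_Ioc]
      filter_upwards [hC n, hC 0] with t h₁ h₂ ht
      have hn : (0 : ℝ) ≤ n := n.cast_nonneg
      rw [← h₁ ⟨by linarith [ht.1], by linarith [ht.2]⟩,
        ← h₂ ⟨by push_cast; linarith [ht.1], by push_cast; linarith [ht.2]⟩]
    have : (ae (volume.restrict (Ioc (-1 : ℝ) 1))).NeBot := by
      rw [ae_neBot, Ne, Measure.restrict_eq_zero, Real.volume_Ioc]
      norm_num
    exact h₁.exists.choose_spec
  have hG : LocAC fun t => ∫ s in (0 : ℝ)..t, z s := locAC_integral hzl 0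
  refine ⟨(fun _ => C 0) + (-1 : ℂ) • fun t => ∫ s in (0 : ℝ)..t, z s,
    (locAC_const _).add (hG.smul _), ?_, ?_⟩
  · filter_upwards [ae_all_iff.2 hC] with t ht
    obtain ⟨n, hn⟩ := exists_nat_ge |t|
    have hn' := abs_le.1 hn
    have := ht n ⟨by linarith, by linarith⟩
    rw [hCn n] at this
    simp [← this]
  · refine (memLp_congr_ae ?_).2 (Lp.memLp z).neg
    filter_upwards [LocallyIntegrable.ae_hasDerivAt_integral hzl] with t ht
    have := ((hasDerivAt_const t (C 0)).add ((ht 0).const_smul (-1 : ℂ))).deriv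
    simpa using this

theorem momentum_apply (x : momentum.domain) :
    momentum x = (1 / Complex.I : ℂ) • lineDeriv ⟨x, x.2⟩ := rfl

theorem isSelfAdjoint_momentum : IsSelfAdjoint momentum := by
  refine isSelfAdjoint_of_symmetric dense_lineDeriv_domain (fun x y => ?_) fun y z h => ?_
  · rw [momentum_apply, momentum_apply, inner_smul_left, inner_smul_right,
      inner_lineDeriv_left ⟨x, x.2⟩ ⟨y, y.2⟩]
    simp
  -- The inner product is conjugate-linear on the left, so `-i` comes out as `i` and cancels the `1
  -- / i` of momentum.
  · refine mem_lineDeriv_domain_of_weak_deriv (z := (-Complex.I) • z) fun x => ?_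
    rw [inner_smul_left, h ⟨x, x.2⟩, momentum_apply, inner_smul_right, ← mul_assoc]
    simp

/-- The indicator function of `[0, 1]` has no continuous representative. -/
theorem momentum_domain_ne_top : momentum.domain ≠ ⊤ := by
  intro htop
  have hm : MeasurableSet (Icc (0 : ℝ) 1) := measurableSet_Icc
  have hfin : volume (Icc (0 : ℝ) 1) ≠ ⊤ := by simp
  have hmem : indicatorConstLp 2 hm hfin (1 : ℂ) ∈ momentum.domain := by rw [htop]; trivial
  obtain ⟨g, hg, e, -⟩ := hmem
  have e' := e.symm.trans indicatorConstLp_coeFn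
  have h₁ : EqOn g (fun _ => 1) (Ioo 0 1) := by
    refine Measure.eqOn_open_of_ae_eq (μ := volume) ?_ isOpen_Ioo hg.continuous.continuousOn
      continuousOn_const
    refine (ae_restrict_iff' measurableSet_Ioo).2 ?_
    filter_upwards [e'] with t ht ht'
    rw [ht, indicator_of_mem (Ioo_subset_Icc_self ht')]
  have h₂ : EqOn g (fun _ => 0) (Iio 0) := by
    refine Measure.eqOn_open_of_ae_eq (μ := volume) ?_ isOpen_Iio hg.continuous.continuousOn
      continuousOn_const
    refine (ae_restrict_iff' measurableSet_Iio).2 ?_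
    filter_upwards [e'] with t ht ht'
    rw [ht, indicator_of_notMem fun h => absurd h.1 (not_le.2 ht')]
  have h₁' := h₁.closure hg.continuous continuous_const
  have h₂' := h₂.closure hg.continuous continuous_const
  rw [closure_Ioo (by norm_num)] at h₁'
  rw [closure_Iio] at h₂'
  have := (h₁' (left_mem_Icc.2 zero_le_one)).symm.trans (h₂' (mem_Iic.2 le_rfl))
  exact one_ne_zero this

end Momentum

end InfShift

namespace InfShift

open scoped ComplexConjugate InnerProductSpace Topology
open Filter Set

/-! ### The unitary `W` and the equivalence of `V_c` with momentum -/

section Weight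

variable (c : ℝ)

/-- Multiplication by `e^{-ct}` transforms the weighted `L²` norm into the unweighted one. -/
theorem eLpNorm_exp_mul (f : ℝ → ℂ) :
    eLpNorm (fun t => (Real.exp (-c * t) : ℂ) * f t) 2 volume = eLpNorm f 2 (weight c) := by
  -- No measurability of `f` is assumed, so the change of density relies only on the weight being
  -- measurable and finite.
  rw [eLpNorm_eq_lintegral_rpow_enorm_toReal two_ne_zero ENNReal.ofNat_ne_top,
    eLpNorm_eq_lintegral_rpow_enorm_toReal two_ne_zero ENNReal.ofNat_ne_top, weight,
    lintegral_withDensity_eq_lintegral_mul_non_measurable _ (by fun_prop)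
      (.of_forall fun t => ENNReal.ofReal_lt_top)]
  congr 1
  refine lintegral_congr fun t => ?_
  have h : ‖(Real.exp (-c * t) : ℂ)‖ₑ ^ (2 : ℝ) = ENNReal.ofReal (Real.exp (-2 * c * t)) := by
    rw [← ofReal_norm, Complex.norm_real, Real.norm_of_nonneg (Real.exp_pos _).le,
      ENNReal.ofReal_rpow_of_pos (Real.exp_pos _), ← Real.exp_mul]
    congr 2
    ring
  simp only [ENNReal.toReal_ofNat, Pi.mul_apply]
  rw [enorm_mul, ENNReal.mul_rpow_of_nonneg _ _ (by norm_num), h]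

theorem contDiff_exp_mul (a : ℝ) : ContDiff ℝ 1 fun t : ℝ => (Real.exp (a * t) : ℂ) :=
  Complex.ofRealCLM.contDiff.comp (Real.contDiff_exp.comp (contDiff_const.mul contDiff_id))

theorem hasDerivAt_exp_mul (a t : ℝ) :
    HasDerivAt (fun t : ℝ => (Real.exp (a * t) : ℂ)) (a * Real.exp (a * t)) t := by
  have h : HasDerivAt (fun t : ℝ => Real.exp (a * t)) (Real.exp (a * t) * (a * 1)) t :=
    ((hasDerivAt_id t).const_mul a).exp
  convert! h.ofReal_comp using 1
  push_cast
  ring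

theorem exp_mul_exp_neg_mul (t : ℝ) (z : ℂ) :
    (Real.exp (-c * t) : ℂ) * (Real.exp (c * t) * z) = z := by
  rw [← mul_assoc, ← Complex.ofReal_mul, ← Real.exp_add]
  simp

theorem exp_neg_mul_exp_mul (t : ℝ) (z : ℂ) :
    (Real.exp (c * t) : ℂ) * (Real.exp (-c * t) * z) = z := by
  rw [← mul_assoc, ← Complex.ofReal_mul, ← Real.exp_add]
  simp

theorem memLp_exp_mul_iff (f : ℝ → ℂ) :
    MemLp (fun t => (Real.exp (-c * t) : ℂ) * f t) 2 volume ↔ MemLp f 2 (weight c) := by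
  have hm : AEStronglyMeasurable (fun t => (Real.exp (-c * t) : ℂ) * f t) volume
      ↔ AEStronglyMeasurable f (weight c) := by
    constructor
    · intro h
      have := (contDiff_exp_mul c).continuous.aestronglyMeasurable.mul h
      refine (this.congr (.of_forall fun t => ?_)).mono_ac (weight_ac c)
      exact exp_neg_mul_exp_mul c t (f t)
    · intro h
      exact (contDiff_exp_mul (-c)).continuous.aestronglyMeasurable.mul (h.mono_ac (ac_weight c))
  rw [MemLp, MemLp, hm, eLpNorm_exp_mul]

/-- The unitary `(W f)(t) = e^{-ct} f(t)` from `ℍ_c` onto `L²(ℝ, dt)`. -/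
noncomputable def expUnitary : Hc c ≃ₗᵢ[ℂ] Lp ℂ 2 (volume : Measure ℝ) :=
  LinearIsometryEquiv.ofSurjective
    { toFun := fun f => ((memLp_exp_mul_iff c f).2 (Lp.memLp f)).toLp _
      map_add' := fun f g => by
        rw [← MemLp.toLp_add, MemLp.toLp_eq_toLp_iff]
        filter_upwards [(ac_weight c).ae_le (Lp.coeFn_add f g)] with t ht
        simp only [Pi.add_apply] at ht ⊢
        rw [ht, mul_add]
      map_smul' := fun z f => by
        rw [RingHom.id_apply, ← MemLp.toLp_const_smul, MemLp.toLp_eq_toLp_iff]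
        filter_upwards [(ac_weight c).ae_le (Lp.coeFn_smul z f)] with t ht
        simp only [Pi.smul_apply, smul_eq_mul] at ht ⊢
        rw [ht]
        ring
      norm_map' := fun f => by
        change ‖((memLp_exp_mul_iff c f).2 (Lp.memLp f)).toLp _‖ = _
        rw [Lp.norm_toLp, eLpNorm_exp_mul, Lp.norm_def] }
    (fun g => by
      have hg : MemLp (fun t => (Real.exp (c * t) : ℂ) * g t) 2 (weight c) := by
        rw [← memLp_exp_mul_iff]
        simp only [exp_mul_exp_neg_mul]
        exact Lp.memLp g
      refine ⟨hg.toLp _, ?_⟩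
      change ((memLp_exp_mul_iff c _).2 (Lp.memLp (hg.toLp _))).toLp _ = _
      refine Lp.ext ((MemLp.coeFn_toLp _).trans ?_)
      filter_upwards [(ac_weight c).ae_le hg.coeFn_toLp] with t ht
      rw [ht, exp_mul_exp_neg_mul])

theorem expUnitary_ae_eq (f : Hc c) :
    ∀ᵐ t : ℝ, expUnitary c f t = (Real.exp (-c * t) : ℂ) * f t :=
  ((memLp_exp_mul_iff c f).2 (Lp.memLp f)).coeFn_toLp

variable {c}

theorem LocAC.exp_mul {g : ℝ → ℂ} (hg : LocAC g) (a : ℝ) :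
    LocAC fun t => (Real.exp (a * t) : ℂ) * g t :=
  (LocAC.of_contDiff (contDiff_exp_mul a)).mul hg

theorem LocAC.deriv_exp_mul {g : ℝ → ℂ} (hg : LocAC g) (a : ℝ) :
    ∀ᵐ t, deriv (fun t => (Real.exp (a * t) : ℂ) * g t) t
      = Real.exp (a * t) * (deriv g t + a * g t) := by
  filter_upwards [hg.ae_differentiableAt] with t ht
  rw [((hasDerivAt_exp_mul a t).fun_mul ht.hasDerivAt).deriv]
  ring

/-- Multiplying a representative by `e^{±ct}` keeps it absolutely continuous. Its derivative gains
only a multiple of the function itself, which is already square integrable. -/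
theorem expUnitary_mem_domain_iff (f : Hc c) :
    expUnitary c f ∈ lineDeriv.domain ↔ f ∈ (shift c).domain := by
  constructor
  · rintro ⟨k, hk, ek, mk⟩
    have mk₀ : MemLp k 2 := (memLp_congr_ae ek).1 (Lp.memLp _)
    refine ⟨_, hk.exp_mul c, ?_, ?_⟩
    · filter_upwards [(weight_ac c).ae_le (expUnitary_ae_eq c f), (weight_ac c).ae_le ek]
        with t h₁ h₂
      rw [← h₂, h₁, exp_neg_mul_exp_mul]
    · rw [← memLp_exp_mul_iff]
      refine (memLp_congr_ae ?_).2 (mk.add (mk₀.const_mul (c : ℂ)))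
      filter_upwards [hk.deriv_exp_mul c] with t ht
      rw [ht, exp_mul_exp_neg_mul]
      rfl
  · rintro ⟨g, hg, eg, mg⟩
    have mg₀ : MemLp g 2 (weight c) := (memLp_congr_ae eg).1 (Lp.memLp _)
    refine ⟨_, hg.exp_mul (-c), ?_, ?_⟩
    · filter_upwards [expUnitary_ae_eq c f, (ac_weight c).ae_le eg] with t h₁ h₂
      rw [h₁, h₂]
    · refine (memLp_congr_ae ?_).2
        ((memLp_exp_mul_iff c _).2 (mg.add (mg₀.const_mul (-c : ℂ))))
      filter_upwards [hg.deriv_exp_mul (-c)] with t ht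
      rw [ht]
      simp

theorem lineDeriv_expUnitary (f : (shift c).domain) :
    lineDeriv ⟨expUnitary c f, (expUnitary_mem_domain_iff _).2 f.2⟩
      = expUnitary c (shift c f - (c : ℂ) • (f : Hc c)) := by
  obtain ⟨g, hg, eg, mg⟩ := f.2
  have e : (expUnitary c f : ℝ → ℂ) =ᵐ[volume] fun t => (Real.exp (-c * t) : ℂ) * g t := by
    filter_upwards [expUnitary_ae_eq c f, (ac_weight c).ae_le eg] with t h₁ h₂
    rw [h₁, h₂]
  refine Lp.ext ((derivOp_ae_eq _ _ ⟨expUnitary c f, _⟩ (hg.exp_mul (-c)) e).trans ?_)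
  filter_upwards [hg.deriv_exp_mul (-c), expUnitary_ae_eq c (shift c f - (c : ℂ) • (f : Hc c)),
    (ac_weight c).ae_le (Lp.coeFn_sub (shift c f) ((c : ℂ) • (f : Hc c))),
    (ac_weight c).ae_le (Lp.coeFn_smul (c : ℂ) (f : Hc c)), (ac_weight c).ae_le eg,
    (ac_weight c).ae_le (derivOp_ae_eq (ac_weight c) (weight_ac c) f hg eg)] with t h₁ h₂ h₃ h₄ h₅ h₆
  rw [h₁, h₂, h₃, Pi.sub_apply, h₄, Pi.smul_apply, h₅]
  change _ = _ * (derivOp (ac_weight c) (weight_ac c) f t - _)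
  rw [h₆]
  push_cast
  rw [smul_eq_mul]
  ring

theorem Vop_domain (c : ℝ) : (Vop c).domain = (shift c).domain :=
  imPart_domain _ c

theorem Vop_apply (x : (Vop c).domain) :
    Vop c x = (1 / Complex.I : ℂ) • (shift c ⟨x, x.2.1⟩ - (c : ℂ) • (x : Hc c)) :=
  imPart_apply x

theorem unitaryConj_expUnitary_Vop (c : ℝ) : unitaryConj (expUnitary c) (Vop c) = momentum := by
  have hmem : ∀ y, y ∈ (unitaryConj (expUnitary c) (Vop c)).domain ↔ y ∈ momentum.domain := by
    intro y
    change (expUnitary c).symm y ∈ (Vop c).domain ↔ y ∈ lineDeriv.domain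
    rw [Vop_domain, ← expUnitary_mem_domain_iff, LinearIsometryEquiv.apply_symm_apply]
  refine LinearPMap.ext (SetLike.ext hmem) fun y hy hy' => ?_
  rw [unitaryConj_apply, momentum_apply, Vop_apply, map_smul]
  congr 1
  have h : (expUnitary c).symm y ∈ (shift c).domain := hy.1
  rw [← lineDeriv_expUnitary ⟨(expUnitary c).symm y, h⟩]
  exact congrArg _ (Subtype.ext ((expUnitary c).apply_symm_apply y))

end Weight

end InfShift

namespace InfShift

open scoped ComplexConjugate InnerProductSpace

/-! ### Self-adjointness of `V_c` and properness of the domain -/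

section Shift

theorem isSelfAdjoint_Vop (c : ℝ) : IsSelfAdjoint (Vop c) :=
  isSelfAdjoint_of_unitaryConj (expUnitary c)
    ((unitaryConj_expUnitary_Vop c).symm ▸ isSelfAdjoint_momentum)

theorem shift_domain_ne_top (c : ℝ) : (shift c).domain ≠ ⊤ := by
  intro h
  refine momentum_domain_ne_top (Submodule.eq_top_iff'.2 fun y => ?_)
  have := (expUnitary_mem_domain_iff (c := c) ((expUnitary c).symm y)).2 (by rw [h]; trivial)
  rwa [LinearIsometryEquiv.apply_symm_apply] at this

end Shift

end InfShift


theorem mainTheorem8 (c : ℝ) (hc : 0 ≤ c) :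
    -- the shift is an unbounded normal operator
    IsUnboundedOp (shift c) ∧ IsNormalOp (shift c) ∧
    -- its adjoint is `2c - ∂_c`, with the same domain
    (shift c).adjoint.domain = (shift c).domain ∧
    (shift c).adjoint = scalarOn (2 * c : ℂ) (shift c).domain - shift c ∧
    -- `∂_c = c + i V_c` with `c = Re ∂_c`, `V_c = Im ∂_c`
    (Vop c).domain = (shift c).domain ∧
    shift c = scalarOn (c : ℂ) (shift c).domain + Complex.I • Vop c ∧
    reOp (shift c) = scalarOn (c : ℂ) (shift c).domain ∧
    imOp (shift c) = Vop c ∧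
    -- `V_c` is an unbounded self-adjoint operator
    IsUnboundedOp (Vop c) ∧ IsSelfAdjoint (Vop c) ∧
    -- `V_c` is unitarily equivalent to the momentum operator, through `(W f)(t) = e^{-ct} f(t)`
    ∃ W : Hc c ≃ₗᵢ[ℂ] Lp ℂ 2 (volume : Measure ℝ),
      (∀ f : Hc c, ∀ᵐ t : ℝ, W f t = (Real.exp (-c * t) : ℂ) * f t) ∧
      unitaryConj W (Vop c) = momentum := by

  -- `Vop c` unfolds to `imPart (shift c) c`, so the results on `c + iV` apply to the shift.
  have hV : IsSelfAdjoint (imPart (shift c) c) := isSelfAdjoint_Vop c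
  have hD := adjoint_domain_of_imPart hV
  refine ⟨isUnboundedOp_of_adjoint_domain_ne_top ?_, isNormalOp_of_imPart hV, hD,
    adjoint_eq_scalarOn_sub hV, Vop_domain c, eq_scalarOn_add_imPart _ c, reOp_eq_scalarOn hV,
    imOp_eq_imPart hV, isUnboundedOp_of_adjoint_domain_ne_top ?_, hV, expUnitary c,
    expUnitary_ae_eq c, unitaryConj_expUnitary_Vop c⟩
  · rw [hD]
    exact shift_domain_ne_top c
  · rw [LinearPMap.isSelfAdjoint_def.1 (isSelfAdjoint_Vop c), Vop_domain]
    exact shift_domain_ne_top c
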